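/- Let $M$ be a smooth Riemannian manifold, and let $K\subset S\subset M$ be closed smooth codimension-$0$ submanifolds with boundary. Put $S_K=\overline{S\setminus K}$. A generalised geodesic in $S_K$ is a unit speed curve $\gamma:[a,b]\to S_K$, $a<b$, made of finitely many smooth geodesic segments, such that at each time where the velocity jumps $\gamma$ is on $\partial K$ and $\langle\dot\gamma(t^-),v\rangle=\langle\dot\gamma(t^+),v\rangle$ for all $v$ tangent to $\partial K$. Let $\gamma$ be a (necessarily non-trapped) generalised geodesic in $S_K$ from $x=\gamma(a)\in\partial S$ to $y=\gamma(b)\in\partial S$, with division times $a=t_0<t_1<\dots<t_n=b$ between which it is a smooth geodesic. Then $\operatorname{grad}_xT=-\dot\gamma(a)/\|\dot\gamma(a)\|$, where $T(x,y)$ is the length of $\gamma$, in the following sense. (1) For every smooth variation $(\gamma_h)$ of $\gamma=\gamma_0$ through piecewise smooth curves in $M$ with the end point $y$ fixed (division times $\tau_i(h)$ with $\tau_i(0)=t_i$, and the segments, depend smoothly on $h$, and those division points at which the velocity of $\gamma$ jumps stay on $\partial K$), the length $L(\gamma_h)$ is differentiable at $h=0$ and $$\frac{d}{dh}L(\gamma_h)\Big|_{h=0}=-\Big\langle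 \frac{\dot\gamma(a)}{\|\dot\gamma(a)\|},\ \frac{d}{dh}\Big|_{h=0}\gamma_h(\tau_0(h))\Big\rangle .$$ (2) Let $A\subset M$ contain $x$ (for example $A=\partial S$), and let $(\gamma_p)$, for $p\in A$ near $x$, be a family of generalised geodesics in $S_K$, with $\gamma_p$ going from $p$ to $y$ and $\gamma_x=\gamma$, whose division times and segments depend smoothly on $p$ (i.e. extend smoothly to a neighbourhood of $x$ in $M$) and whose division points, where the velocity of $\gamma$ jumps, stay on $\partial K$. Then the travelling time $T(p)=T(p,y)=L(\gamma_p)$ has at $x$, along $A$, the gradient $-\dot\gamma(a)/\|\dot\gamma(a)\|$: in a chart, $T(p)=T(x)-\langle\dot\gamma(a)/\|\dot\gamma(a)\|,\,p-x\rangle+o(|p-x|)$ as $p\to x$ in $A$. -/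

import Mathlib

open Set Filter MeasureTheory Bundle Manifold
open scoped Topology ContDiff

noncomputable section

namespace Billiard

section SmoothDomains

variable {E : Type*} [NormedAddCommGroup E] [NormedSpace ℝ E]
  {M : Type*} [TopologicalSpace M] [ChartedSpace E M]

/-- `ρ` is a smooth defining function of `K` near `q`: it has nonzero differential at `q`, vanishes
at `q`, and `K` is the sublevel set `{ρ ≤ 0}` near `q`. -/
def IsDefiningFunctionAt (K : Set M) (ρ : M → ℝ) (q : M) : Prop :=
  ContMDiffAt 𝓘(ℝ, E) 𝓘(ℝ, ℝ) ∞ ρ q ∧ mfderiv 𝓘(ℝ, E) 𝓘(ℝ, ℝ) ρ q ≠ 0 ∧ ρ q = 0 ∧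
    ∀ᶠ z in 𝓝 q, (z ∈ K ↔ ρ z ≤ 0)

variable (E) in
/-- A (properly embedded) smooth submanifold with boundary of codimension `0`: a closed set which
has a smooth defining function near each of its boundary points. Its boundary as a manifold is its
topological frontier. -/
def IsSmoothDomain (K : Set M) : Prop :=
  IsClosed K ∧ ∀ q ∈ frontier K, ∃ ρ : M → ℝ, IsDefiningFunctionAt (E := E) K ρ q

/-- `v` is tangent to `∂K` at `q`, i.e. it lies in the kernel of the differential of a
defining function. -/
def IsTangentToBoundary (K : Set M) (q : M) (v : TangentSpace 𝓘(ℝ, E) q) : Prop :=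
  ∃ ρ : M → ℝ, IsDefiningFunctionAt (E := E) K ρ q ∧ mfderiv 𝓘(ℝ, E) 𝓘(ℝ, ℝ) ρ q v = 0

/-- The region `S_K`, the closure of `S \ K`. -/
def exteriorRegion (K S : Set M) : Set M := closure (S \ K)

variable (E) in
/-- The velocity of the curve `γ` at time `s` from the right. -/
def velRight (γ : ℝ → M) (s : ℝ) : TangentSpace 𝓘(ℝ, E) (γ s) :=
  mfderivWithin 𝓘(ℝ, ℝ) 𝓘(ℝ, E) γ (Ici s) s (1 : ℝ)

variable (E) in
/-- The velocity of the curve `γ` at time `s` from the left. -/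
def velLeft (γ : ℝ → M) (s : ℝ) : TangentSpace 𝓘(ℝ, E) (γ s) :=
  mfderivWithin 𝓘(ℝ, ℝ) 𝓘(ℝ, E) γ (Iic s) s (1 : ℝ)

end SmoothDomains

section Riemannian

variable {E : Type*} [NormedAddCommGroup E] [NormedSpace ℝ E]
  {M : Type*} [TopologicalSpace M] [ChartedSpace E M]
  [RiemannianBundle (fun x : M => TangentSpace 𝓘(ℝ, E) x)]

/-- The Riemannian metric read in the chart `e`: `g_z(a, b)` for `z` in the target of `e`. -/
def chartMetric (e : OpenPartialHomeomorph M E) (z a b : E) : ℝ :=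
  inner ℝ (mfderiv 𝓘(ℝ, E) 𝓘(ℝ, E) e.symm z a : TangentSpace 𝓘(ℝ, E) (e.symm z))
    (mfderiv 𝓘(ℝ, E) 𝓘(ℝ, E) e.symm z b : TangentSpace 𝓘(ℝ, E) (e.symm z))

/-- The number `g(D_t u̇, w)` at time `t`, for the curve `u` in the chart `e` and the Levi-Civita
connection of `g`. Since the Christoffel symbols satisfy
`g(Γ(a, b), w) = (∂_a g(b, w) + ∂_b g(a, w) - ∂_w g(a, b)) / 2`,
it is `g(ü, w) + ∂_u̇ g(u̇, w) - ∂_w g(u̇, u̇) / 2`. -/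
def chartCovAcc (e : OpenPartialHomeomorph M E) (u : ℝ → E) (t : ℝ) (w : E) : ℝ :=
  chartMetric e (u t) (deriv (deriv u) t) w
    + fderiv ℝ (fun z => chartMetric e z (deriv u t) w) (u t) (deriv u t)
    - 1 / 2 * fderiv ℝ (fun z => chartMetric e z (deriv u t) (deriv u t)) (u t) w

variable (E) in
/-- `γ` is a smooth geodesic on `[a, b]` (smooth up to the end points): it satisfies the geodesic
equation `D_t γ̇ = 0` in every chart. -/
def IsGeodesicOn (γ : ℝ → M) (a b : ℝ) : Prop :=
  ContMDiffOn 𝓘(ℝ, ℝ) 𝓘(ℝ, E) ∞ γ (Icc a b) ∧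
    ∀ t ∈ Ioo a b, ∀ e ∈ atlas E M, γ t ∈ e.source →
      ∀ w : E, chartCovAcc e (fun s => e (γ s)) t w = 0

variable (E) in
/-- `γ`, restricted to `[t 0, t n]`, is a generalised geodesic in `S_K`, split into the segments
`[t i, t (i + 1)]`, `i < n`: it stays in `S_K`, each segment is a smooth unit speed geodesic, and at
each interior division time at which the velocity jumps, the curve is on `∂K` and the velocities
before and after have the same inner product with every vector tangent to `∂K`. -/
structure IsGenGeodesic (K S : Set M) (γ : ℝ → M) (n : ℕ) (t : ℕ → ℝ) : Prop where
  pos : 0 < n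
  lt : ∀ i < n, t i < t (i + 1)
  mem : ∀ s ∈ Icc (t 0) (t n), γ s ∈ exteriorRegion K S
  geodesic : ∀ i < n, IsGeodesicOn E γ (t i) (t (i + 1))
  unit_right : ∀ i < n, ∀ s ∈ Ico (t i) (t (i + 1)), ‖velRight E γ s‖ = 1
  unit_left : ∀ i < n, ∀ s ∈ Ioc (t i) (t (i + 1)), ‖velLeft E γ s‖ = 1
  reflect : ∀ i, 0 < i → i < n → velLeft E γ (t i) ≠ velRight E γ (t i) →
    γ (t i) ∈ frontier K ∧ ∀ v : TangentSpace 𝓘(ℝ, E) (γ (t i)),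
      IsTangentToBoundary K (γ (t i)) v →
        inner ℝ (velLeft E γ (t i)) v = inner ℝ (velRight E γ (t i)) v

variable (E) in
/-- `f` has gradient `w` at `x` along the set `A`:
`f p = f x + ⟨w, p - x⟩ + o(|p - x|)` for `p ∈ A` in a chart. -/
def HasGradWithinAt (f : M → ℝ) (A : Set M) (x : M) (w : TangentSpace 𝓘(ℝ, E) x) : Prop :=
  ∃ L : TangentSpace 𝓘(ℝ, E) x →L[ℝ] ℝ, HasMFDerivWithinAt 𝓘(ℝ, E) 𝓘(ℝ, ℝ) f A x L ∧
    ∀ v : TangentSpace 𝓘(ℝ, E) x, L v = inner ℝ w v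

variable (E) in
/-- The length of `γ` on `[a, b]` as a real number. -/
def curveLength (γ : ℝ → M) (a b : ℝ) : ℝ :=
  (pathELength 𝓘(ℝ, E) γ a b).toReal

variable (E) in
/-- `Γ p`, on `[τ 0 p, τ n p]`, for `p ∈ A` near `p₀`, is a smooth variation, with fixed end point,
of the piecewise smooth curve `γ` with division times `t 0 < ⋯ < t n`: the division times `τ i p`
and the segments of `Γ p` depend smoothly on the parameter `p` (the segments jointly with time, up
to their end points); the end point `Γ p (τ n p)` is constant; and the division points at which the
velocity of `γ` jumps vary in `∂K`. The starting point `Γ p (τ 0 p)` is free. The curves `Γ p`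
need not be geodesics. -/
structure IsVariation {F : Type*} [NormedAddCommGroup F] [NormedSpace ℝ F]
    {P : Type*} [TopologicalSpace P] [ChartedSpace F P]
    (K : Set M) (γ : ℝ → M) (n : ℕ) (t : ℕ → ℝ)
    (A : Set P) (p₀ : P) (Γ : P → ℝ → M) (τ : ℕ → P → ℝ) : Prop where
  mem : p₀ ∈ A
  time_base : ∀ i ≤ n, τ i p₀ = t i
  curve_base : ∀ s ∈ Icc (t 0) (t n), Γ p₀ s = γ s
  time_smooth : ∀ i ≤ n, ContMDiffAt 𝓘(ℝ, F) 𝓘(ℝ, ℝ) ∞ (τ i) p₀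
  segment_smooth : ∀ i < n, ∃ G : P × ℝ → M,
    (∀ s ∈ Icc (t i) (t (i + 1)),
      ContMDiffAt (𝓘(ℝ, F).prod 𝓘(ℝ, ℝ)) 𝓘(ℝ, E) ∞ G (p₀, s)) ∧
    ∀ᶠ p in 𝓝[A] p₀, ∀ s ∈ Icc (τ i p) (τ (i + 1) p), Γ p s = G (p, s)
  end_fixed : ∀ᶠ p in 𝓝[A] p₀, Γ p (τ n p) = γ (t n)
  reflect : ∀ i, 0 < i → i < n → velLeft E γ (t i) ≠ velRight E γ (t i) →
    ∀ᶠ p in 𝓝[A] p₀, Γ p (τ i p) ∈ frontier K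

end Riemannian

end Billiard

end

/-! This is the first variation formula with reflection terms. Near the base parameter the length is
the sum over the segments of `∫ √(energy)`. Since the base curve has unit speed, the derivative of
`√(energy)` in a parameter direction `v` is half that of `energy`. The geodesic equation and the
symmetry of second derivatives identify it with `d/ds g(γ̇, ∂ᵥG)`. The integral therefore leaves
only boundary values of `pairing`. Moving the end times contributes `dτ`, again by unit speed, and
together these give `g(γ̇, ·)` applied to the total derivative of `p ↦ G (p, τ p)`, the motion of
the division point (`hasFDerivAt_integral_speed`).

The two segments meeting at a division point see the same moving point, so their boundary terms
differ by `g(γ̇⁻ - γ̇⁺, motion)`. This is zero if there is no jump. At a jump the reflection law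
makes the covector `g(γ̇⁻ - γ̇⁺, ·)` a multiple of `dρ`, and `ρ` vanishes along the motion, which
stays on `∂K` (`hasFDerivWithinAt_zero_of_mem_frontier`). The final point is fixed, so only the
initial term `-g(γ̇(a), motion)` survives the telescoping. For the travelling time the starting
point is `p` itself, so its motion is the identity.

The parameter set `A` is arbitrary, so derivatives along it need not be unique. Cancellation is
therefore phrased as: the zero function has derivative `ℓ` along `A`, that is, `ℓ (p - p₀) = o(|p -
p₀|)`. Such null covectors can be added freely to a derivative. -/

noncomputable section

namespace Billiard


/-! ### Parameter integrals and the geodesic computation in a vector space -/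

section Calculus

variable {E : Type*} [NormedAddCommGroup E] [NormedSpace ℝ E]
  {F : Type*} [NormedAddCommGroup F] [NormedSpace ℝ F]

theorem intervalIntegrable_slice {F : Type*} [TopologicalSpace F] {f : F × ℝ → ℝ} {p : F} {a b : ℝ}
    (hf : ∀ s ∈ uIcc a b, ContinuousAt f (p, s)) :
    IntervalIntegrable (fun s => f (p, s)) volume a b := by
  apply ContinuousOn.intervalIntegrable
  intro s hs
  exact ((hf s hs).comp (f := fun s : ℝ => (p, s))
    (by fun_prop : ContinuousAt (fun s : ℝ => (p, s)) s)).continuousWithinAt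

/-- Differentiation under the integral sign, for an integrand which is `C¹` near the segment. -/
theorem hasFDerivAt_integral_fixed {f : F × ℝ → ℝ} {p₀ : F} {a b : ℝ} (hab : a ≤ b)
    (hf : ∀ s ∈ Icc a b, ContDiffAt ℝ 1 f (p₀, s)) :
    HasFDerivAt (fun p => ∫ s in a..b, f (p, s))
      (∫ s in a..b, (fderiv ℝ f (p₀, s)).comp (ContinuousLinearMap.inl ℝ F ℝ)) p₀ := by
  have hcont : ContinuousOn (fun s => (fderiv ℝ f (p₀, s)).comp (ContinuousLinearMap.inl ℝ F ℝ))
      (Icc a b) := by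
    intro s hs
    have h1 : ContinuousAt (fderiv ℝ f) (p₀, s) :=
      ((hf s hs).fderiv_right (m := 0) (by norm_num)).continuousAt
    have h2 : ContinuousAt (fun s : ℝ => fderiv ℝ f (p₀, s)) s :=
      h1.comp (f := fun s : ℝ => (p₀, s)) (by fun_prop)
    exact (h2.clm_comp continuousAt_const).continuousWithinAt
  have hint := hcont.intervalIntegrable_of_Icc (μ := volume) hab
  have hev : ∀ᶠ p in 𝓝 p₀, ∀ s ∈ Icc a b, ContinuousAt f (p, s) := by
    refine isCompact_Icc.eventually_forall_of_forall_eventually fun s hs => ?_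
    exact ((hf s hs).eventually (by simp)).mono fun x hx => hx.continuousAt
  rw [hasFDerivAt_iff_isLittleO, Asymptotics.isLittleO_iff]
  intro ε hε
  -- The `+ 1` in the denominator covers the degenerate interval `a = b`.
  obtain ⟨δ, hδ, hδε⟩ : ∃ δ > 0, δ * |b - a| ≤ ε := by
    refine ⟨ε / (|b - a| + 1), by positivity, ?_⟩
    rw [div_mul_eq_mul_div, div_le_iff₀ (by positivity)]
    nlinarith [abs_nonneg (b - a)]
  have hunif : ∀ᶠ p in 𝓝 p₀, ∀ s ∈ Icc a b,
      ‖f (p, s) - f (p₀, s) - fderiv ℝ f (p₀, s) (p - p₀, 0)‖ ≤ δ * ‖p - p₀‖ := by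
    refine isCompact_Icc.eventually_forall_of_forall_eventually fun s hs => ?_
    have h1 : ContinuousAt (fderiv ℝ f) (p₀, s) :=
      ((hf s hs).fderiv_right (m := 0) (by norm_num)).continuousAt
    -- Strict differentiability is needed because the base point `(p₀, z.2)` moves with `z`. Half of
    -- `δ` pays for this remainder, half for replacing the derivative at `s` by the one at `z.2`.
    have hstrict := (hf s hs).hasStrictFDerivAt (by simp)
    have h2 := (Asymptotics.isLittleO_iff.mp hstrict.isLittleO) (half_pos hδ)
    have t1 : Tendsto (fun z : F × ℝ => (z, ((p₀, z.2) : F × ℝ))) (𝓝 (p₀, s))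
        (𝓝 ((p₀, s), (p₀, s))) := by
      have : Continuous (fun z : F × ℝ => (z, ((p₀, z.2) : F × ℝ))) := by fun_prop
      exact this.tendsto' _ _ rfl
    have t2 : Tendsto (fun z : F × ℝ => ((p₀, z.2) : F × ℝ)) (𝓝 (p₀, s)) (𝓝 (p₀, s)) := by
      have : Continuous (fun z : F × ℝ => ((p₀, z.2) : F × ℝ)) := by fun_prop
      exact this.tendsto' _ _ rfl
    have h3 := t2.eventually (Metric.continuousAt_iff'.mp h1 (δ / 2) (half_pos hδ))
    filter_upwards [t1.eventually h2, h3] with z hz2 hz3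
    have hz : z - (p₀, z.2) = (z.1 - p₀, 0) := by ext <;> simp
    have hn : ‖((z.1 - p₀, 0) : F × ℝ)‖ = ‖z.1 - p₀‖ := by simp [Prod.norm_def]
    simp only [hz, hn, Prod.mk.eta] at hz2 ⊢
    rw [dist_eq_norm] at hz3
    have hle := (fderiv ℝ f (p₀, z.2) - fderiv ℝ f (p₀, s)).le_of_opNorm_le hz3.le (z.1 - p₀, 0)
    rw [hn, sub_apply] at hle
    calc _ = ‖(f z - f (p₀, z.2) - fderiv ℝ f (p₀, s) (z.1 - p₀, 0)) -
          (fderiv ℝ f (p₀, z.2) (z.1 - p₀, 0) - fderiv ℝ f (p₀, s) (z.1 - p₀, 0))‖ := by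
            congr 1; ring
      _ ≤ δ / 2 * ‖z.1 - p₀‖ + δ / 2 * ‖z.1 - p₀‖ := (norm_sub_le _ _).trans (add_le_add hz2 hle)
      _ = _ := by ring
  filter_upwards [hunif, hev] with p hp hpc
  have i1 : IntervalIntegrable (fun s => f (p, s)) volume a b :=
    intervalIntegrable_slice fun s hs => hpc s (by rwa [uIcc_of_le hab] at hs)
  have i2 : IntervalIntegrable (fun s => f (p₀, s)) volume a b :=
    intervalIntegrable_slice fun s hs => (hf s (by rwa [uIcc_of_le hab] at hs)).continuousAt
  have i3 : IntervalIntegrable (fun s => fderiv ℝ f (p₀, s) (p - p₀, 0)) volume a b := by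
    have : ContinuousOn (fun s => fderiv ℝ f (p₀, s) (p - p₀, 0)) (Icc a b) := by
      have := hcont.clm_apply (continuousOn_const (c := p - p₀))
      simpa using this
    exact this.intervalIntegrable_of_Icc hab
  have e : (∫ s in a..b, (fderiv ℝ f (p₀, s)).comp (ContinuousLinearMap.inl ℝ F ℝ)) (p - p₀)
      = ∫ s in a..b, fderiv ℝ f (p₀, s) (p - p₀, 0) := by
    rw [ContinuousLinearMap.intervalIntegral_apply hint]
    simp
  rw [e, ← intervalIntegral.integral_sub i1 i2, ← intervalIntegral.integral_sub (i1.sub i2) i3]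
  refine (intervalIntegral.norm_integral_le_of_norm_le_const (C := δ * ‖p - p₀‖) ?_).trans ?_
  · intro s hs
    rw [uIoc_of_le hab] at hs
    exact hp s ⟨hs.1.le, hs.2⟩
  · calc δ * ‖p - p₀‖ * |b - a| = δ * |b - a| * ‖p - p₀‖ := by ring
      _ ≤ _ := by gcongr

theorem eventually_uIcc_of_continuousAt {F : Type*} [TopologicalSpace F] {p₀ : F} {τ : F → ℝ}
    (hτ : ContinuousAt τ p₀) {Q : F × ℝ → Prop} (hQ : ∀ᶠ x in 𝓝 (p₀, τ p₀), Q x) :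
    ∀ᶠ p in 𝓝 p₀, ∀ s ∈ uIcc (τ p₀) (τ p), Q (p, s) := by
  rw [nhds_prod_eq] at hQ
  obtain ⟨P₁, h₁, P₂, h₂, h⟩ := Filter.eventually_prod_iff.mp hQ
  obtain ⟨δ, hδ, hball⟩ := Metric.eventually_nhds_iff_ball.mp h₂
  filter_upwards [h₁, hτ (Metric.ball_mem_nhds _ hδ)] with p hp hpτ s hs
  refine h hp (hball s ?_)
  exact (Real.ball_eq_Ioo (τ p₀) δ ▸ ordConnected_Ioo :
    (Metric.ball (τ p₀) δ).OrdConnected).uIcc_subset (Metric.mem_ball_self hδ) hpτ hs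

/-- The interval shrinks to a point at which the integrand is `1`, so the integral is `τ p - τ p₀`
up to `o(|τ p - τ p₀|)`. Continuity of `f` is enough. -/
theorem hasFDerivAt_integral_endpoint {f : F × ℝ → ℝ} {p₀ : F} {τ : F → ℝ} {τ' : F →L[ℝ] ℝ}
    (hτ : HasFDerivAt τ τ' p₀) (hf : ∀ᶠ x in 𝓝 (p₀, τ p₀), ContinuousAt f x)
    (hone : f (p₀, τ p₀) = 1) :
    HasFDerivAt (fun p => ∫ s in τ p₀..τ p, f (p, s)) τ' p₀ := by
  have key : (fun p => (∫ s in τ p₀..τ p, f (p, s)) - (τ p - τ p₀)) =o[𝓝 p₀]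
      fun p => τ p - τ p₀ := by
    rw [Asymptotics.isLittleO_iff]
    intro ε hε
    have h1 : ∀ᶠ x in 𝓝 (p₀, τ p₀), ‖f x - 1‖ ≤ ε := by
      have := Metric.continuousAt_iff'.mp hf.self_of_nhds ε hε
      filter_upwards [this] with x hx
      rw [hone, dist_eq_norm] at hx
      exact hx.le
    filter_upwards [eventually_uIcc_of_continuousAt hτ.continuousAt (h1.and hf)]
      with p hp
    have i1 : IntervalIntegrable (fun s => f (p, s)) volume (τ p₀) (τ p) :=
      intervalIntegrable_slice fun s hs => (hp s hs).2
    have : (∫ s in τ p₀..τ p, f (p, s)) - (τ p - τ p₀) = ∫ s in τ p₀..τ p, (f (p, s) - 1) := by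
      rw [intervalIntegral.integral_sub i1 (by simp)]
      simp
    rw [this, Real.norm_eq_abs (τ p - τ p₀)]
    exact intervalIntegral.norm_integral_le_of_norm_le_const
      fun s hs => (hp s (uIoc_subset_uIcc hs)).1
  rw [hasFDerivAt_iff_isLittleO]
  have h2 := (key.trans_isBigO hτ.isBigO_sub).add hτ.isLittleO
  refine h2.congr_left fun p => ?_
  simp

/-- Derivative of an integral with moving end points, in the form used for the length. -/
theorem hasFDerivAt_integral_moving {f : F × ℝ → ℝ} {p₀ : F} {τ₀ τ₁ : F → ℝ}
    {τ₀' τ₁' : F →L[ℝ] ℝ} (h₀ : HasFDerivAt τ₀ τ₀' p₀) (h₁ : HasFDerivAt τ₁ τ₁' p₀)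
    (hle : τ₀ p₀ ≤ τ₁ p₀) (hf : ∀ s ∈ Icc (τ₀ p₀) (τ₁ p₀), ContDiffAt ℝ 1 f (p₀, s))
    (hone : ∀ s ∈ Icc (τ₀ p₀) (τ₁ p₀), f (p₀, s) = 1) {B : ℝ → F →L[ℝ] ℝ}
    (hBc : ContinuousOn B (Icc (τ₀ p₀) (τ₁ p₀)))
    (hB : ∀ s ∈ Ioo (τ₀ p₀) (τ₁ p₀),
      HasDerivAt B ((fderiv ℝ f (p₀, s)).comp (ContinuousLinearMap.inl ℝ F ℝ)) s) :
    HasFDerivAt (fun p => ∫ s in τ₀ p..τ₁ p, f (p, s))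
      ((B (τ₁ p₀) + τ₁') - (B (τ₀ p₀) + τ₀')) p₀ := by
  have hcont : ContinuousOn (fun s => (fderiv ℝ f (p₀, s)).comp (ContinuousLinearMap.inl ℝ F ℝ))
      (Icc (τ₀ p₀) (τ₁ p₀)) := by
    intro s hs
    have h1 : ContinuousAt (fderiv ℝ f) (p₀, s) :=
      ((hf s hs).fderiv_right (m := 0) (by norm_num)).continuousAt
    have h2 : ContinuousAt (fun s : ℝ => fderiv ℝ f (p₀, s)) s :=
      h1.comp (f := fun s : ℝ => (p₀, s)) (by fun_prop)
    exact (h2.clm_comp continuousAt_const).continuousWithinAt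
  have hmid := hasFDerivAt_integral_fixed hle hf
  -- `B` is a primitive of the parameter derivative, so the integral collapses to boundary values.
  rw [intervalIntegral.integral_eq_sub_of_hasDerivAt_of_le hle hBc hB
    (hcont.intervalIntegrable_of_Icc hle)] at hmid
  have hcev : ∀ s ∈ Icc (τ₀ p₀) (τ₁ p₀), ∀ᶠ x in 𝓝 (p₀, s), ContinuousAt f x := fun s hs =>
    ((hf s hs).eventually (by simp)).mono fun x hx => hx.continuousAt
  have hl := left_mem_Icc.mpr hle
  have hr := right_mem_Icc.mpr hle
  have e₀ := hasFDerivAt_integral_endpoint h₀ (hcev _ hl) (hone _ hl)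
  have e₁ := hasFDerivAt_integral_endpoint h₁ (hcev _ hr) (hone _ hr)
  have hsum := (hmid.add e₁).sub e₀
  have hd : B (τ₁ p₀) - B (τ₀ p₀) + τ₁' - τ₀' = (B (τ₁ p₀) + τ₁') - (B (τ₀ p₀) + τ₀') := by abel
  rw [hd] at hsum
  refine hsum.congr_of_eventuallyEq ?_
  have hmev : ∀ᶠ p in 𝓝 p₀, ∀ s ∈ Icc (τ₀ p₀) (τ₁ p₀), ContinuousAt f (p, s) :=
    isCompact_Icc.eventually_forall_of_forall_eventually hcev
  filter_upwards [hmev,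
    eventually_uIcc_of_continuousAt h₀.continuousAt (hcev _ hl),
    eventually_uIcc_of_continuousAt h₁.continuousAt (hcev _ hr)] with p hm c₀ c₁
  have i₀ := intervalIntegrable_slice c₀
  have i₁ := intervalIntegrable_slice c₁
  have im : IntervalIntegrable (fun s => f (p, s)) volume (τ₀ p₀) (τ₁ p₀) :=
    intervalIntegrable_slice fun s hs => hm s (by rwa [uIcc_of_le hle] at hs)
  have := intervalIntegral.integral_interval_sub_left (im.trans i₁) i₀
  simp only [Pi.add_apply, Pi.sub_apply]
  rw [intervalIntegral.integral_add_adjacent_intervals im i₁, this]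

set_option synthInstance.maxHeartbeats 200000 in
/-- The computation behind the first variation formula, in a chart with metric `g`: for a family
`u (p, s)` of curves whose member at `p₀` satisfies the geodesic equation at `s`, the time
derivative of `g(∂ₛu, ∂ᵥu)` is half of the `v`-derivative of `g(∂ₛu, ∂ₛu)`. -/
theorem hasDerivAt_metric_pairing {g : E → E →L[ℝ] E →L[ℝ] ℝ} {u : F × ℝ → E} {p₀ : F} {s : ℝ}
    (hu : ContDiffAt ℝ 2 u (p₀, s)) (hg : DifferentiableAt ℝ g (u (p₀, s)))
    (hsymm : ∀ a b, g (u (p₀, s)) a b = g (u (p₀, s)) b a)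
    (hgeo : ∀ w, g (u (p₀, s)) (deriv (deriv fun r => u (p₀, r)) s) w
      + fderiv ℝ g (u (p₀, s)) (deriv (fun r => u (p₀, r)) s) (deriv (fun r => u (p₀, r)) s) w
      - 1 / 2 * fderiv ℝ g (u (p₀, s)) w (deriv (fun r => u (p₀, r)) s)
        (deriv (fun r => u (p₀, r)) s) = 0) :
    HasDerivAt (fun r => (g (u (p₀, r)) (fderiv ℝ u (p₀, r) (0, 1))).comp
        ((fderiv ℝ u (p₀, r)).comp (ContinuousLinearMap.inl ℝ F ℝ)))
      ((1 / 2 : ℝ) • (fderiv ℝ (fun x => g (u x) (fderiv ℝ u x (0, 1)) (fderiv ℝ u x (0, 1)))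
        (p₀, s)).comp (ContinuousLinearMap.inl ℝ F ℝ)) s := by
  set x₀ : F × ℝ := (p₀, s) with hx₀
  have hD : DifferentiableAt ℝ (fderiv ℝ u) x₀ :=
    (hu.fderiv_right (m := 1) (by norm_num)).differentiableAt (by simp)
  -- In a chart, this symmetry plays the role of torsion-freeness: `D_s ∂ᵥu = D_v ∂ₛu`.
  have hsnd : IsSymmSndFDerivAt ℝ u x₀ := hu.isSymmSndFDerivAt (by simp)
  have hline : HasDerivAt (fun r : ℝ => ((p₀, r) : F × ℝ)) (0, 1) s :=
    (hasDerivAt_const s p₀).prodMk (hasDerivAt_id s)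
  have hd1 : (deriv fun r => u (p₀, r)) =ᶠ[𝓝 s] fun r => fderiv ℝ u (p₀, r) (0, 1) := by
    have hev : ∀ᶠ x in 𝓝 x₀, DifferentiableAt ℝ u x :=
      (hu.eventually (by simp)).mono fun x hx => hx.differentiableAt (by simp)
    have ht : Tendsto (fun r : ℝ => ((p₀, r) : F × ℝ)) (𝓝 s) (𝓝 x₀) := hline.continuousAt
    filter_upwards [ht.eventually hev] with r hr
    exact (hr.hasFDerivAt.comp_hasDerivAt r
      ((hasDerivAt_const r p₀).prodMk (hasDerivAt_id r))).deriv
  have hd2 : deriv (deriv fun r => u (p₀, r)) s = fderiv ℝ (fderiv ℝ u) x₀ (0, 1) (0, 1) := by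
    rw [hd1.deriv_eq]
    exact ((hD.hasFDerivAt.comp_hasDerivAt s hline).clm_apply (hasDerivAt_const s _)).deriv.trans
      (by simp)
  have hd1s := hd1.self_of_nhds
  simp only [hd2, hd1s] at hgeo
  have hDline : HasDerivAt (fun r => fderiv ℝ u (p₀, r)) (fderiv ℝ (fderiv ℝ u) x₀ (0, 1)) s :=
    hD.hasFDerivAt.comp_hasDerivAt s hline
  have huline : HasDerivAt (fun r => u (p₀, r)) (fderiv ℝ u x₀ (0, 1)) s :=
    (hu.differentiableAt (by simp)).hasFDerivAt.comp_hasDerivAt s hline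
  have hgline : HasDerivAt (fun r => g (u (p₀, r))) (fderiv ℝ g (u x₀) (fderiv ℝ u x₀ (0, 1))) s :=
    HasFDerivAt.comp_hasDerivAt (E := E →L[ℝ] E →L[ℝ] ℝ) (F := E) s hg.hasFDerivAt huline
  have hB := (hgline.clm_apply (hDline.clm_apply (hasDerivAt_const s ((0, 1) : F × ℝ)))).clm_comp
    (hDline.clm_comp (hasDerivAt_const s (ContinuousLinearMap.inl ℝ F ℝ)))
  convert hB using 1
  have hgu : HasFDerivAt (fun x => g (u x)) ((fderiv ℝ g (u x₀)).comp (fderiv ℝ u x₀)) x₀ :=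
    HasFDerivAt.comp (F := E) (G := E →L[ℝ] E →L[ℝ] ℝ) x₀ hg.hasFDerivAt
      (hu.differentiableAt (by simp)).hasFDerivAt
  have hV : HasFDerivAt (fun x => fderiv ℝ u x (0, 1)) _ x₀ :=
    hD.hasFDerivAt.clm_apply (hasFDerivAt_const ((0, 1) : F × ℝ) x₀)
  have hh := ((hgu.clm_apply hV).clm_apply hV).fderiv
  rw [hh]
  ext v
  -- The geodesic equation is tested against the variation field `∂ᵥu`. The remaining mixed terms
  -- `g(∂ₛu, ∂ᵥ∂ₛu)` match by `hs1` and `hs2`.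
  have hgv := hgeo (fderiv ℝ u x₀ (v, 0))
  have hs1 := hsnd.eq (v, 0) (0, 1)
  have hs2 := hsymm (fderiv ℝ u x₀ (0, 1)) (fderiv ℝ (fderiv ℝ u) x₀ (0, 1) (v, 0))
  simp [← hx₀, hs1] at hgv ⊢
  linarith

end Calculus


/-! ### The Riemannian metric read in a chart -/

section Metric

variable {E : Type*} [NormedAddCommGroup E] [NormedSpace ℝ E]
  {M : Type*} [TopologicalSpace M] [ChartedSpace E M]

/-- The differential of a map from a normed space to `M`, with the tangent spaces of `M` identified
with the model space. -/
def differential {X : Type*} [NormedAddCommGroup X] [NormedSpace ℝ X] (G : X → M) (x : X) :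
    X →L[ℝ] E :=
  mfderiv 𝓘(ℝ, X) 𝓘(ℝ, E) G x

theorem differential_eq_comp_symm [IsManifold 𝓘(ℝ, E) ∞ M] {X : Type*} [NormedAddCommGroup X]
    [NormedSpace ℝ X] {G : X → M} {x : X} {e : OpenPartialHomeomorph M E} (he : e ∈ atlas E M)
    (hG : MDifferentiableAt 𝓘(ℝ, X) 𝓘(ℝ, E) G x) (hx : G x ∈ e.source) :
    differential (E := E) G x
      = (differential (E := E) e.symm (e (G x))).comp (fderiv ℝ (fun y => e (G y)) x) := by
  have hm : IsManifold 𝓘(ℝ, E) 1 M := inferInstance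
  have h1 : MDifferentiableAt 𝓘(ℝ, E) 𝓘(ℝ, E) e.symm (e (G x)) :=
    mdifferentiableAt_atlas_symm he (e.map_source hx)
  have h2 : MDifferentiableAt 𝓘(ℝ, X) 𝓘(ℝ, E) (fun y => e (G y)) x :=
    (mdifferentiableAt_atlas he hx).comp x hG
  have h3 := mfderiv_comp x h1 h2
  have h4 : G =ᶠ[𝓝 x] e.symm ∘ fun y => e (G y) := by
    filter_upwards [hG.continuousAt (e.open_source.mem_nhds hx)] with y hy
    exact (e.left_inv hy).symm
  rw [mfderiv_eq_fderiv] at h3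
  exact h4.mfderiv_eq.trans h3

variable [RiemannianBundle (fun x : M => TangentSpace 𝓘(ℝ, E) x)]

/-- The metric at a point, as a bilinear form on the model space. -/
def metricAt (q : M) : E →L[ℝ] E →L[ℝ] ℝ := innerSL ℝ (E := TangentSpace 𝓘(ℝ, E) q)

theorem metricAt_apply (q : M) (v w : TangentSpace 𝓘(ℝ, E) q) :
    metricAt (E := E) q v w = inner ℝ v w := rfl

theorem metricAt_comm (q : M) (v w : E) : metricAt (E := E) q v w = metricAt (E := E) q w v :=
  real_inner_comm (F := TangentSpace 𝓘(ℝ, E) q) w v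

/-- The metric read in a chart, as a bilinear form on the model space. -/
def chartMetricL (e : OpenPartialHomeomorph M E) (z : E) : E →L[ℝ] E →L[ℝ] ℝ :=
  (metricAt (E := E) (e.symm z)).bilinearComp (differential (E := E) e.symm z)
    (differential (E := E) e.symm z)

theorem chartMetricL_apply (e : OpenPartialHomeomorph M E) (z a b : E) :
    chartMetricL e z a b = chartMetric e z a b := rfl

theorem chartMetricL_comm (e : OpenPartialHomeomorph M E) (z a b : E) :
    chartMetricL e z a b = chartMetricL e z b a := by
  simp only [chartMetricL, ContinuousLinearMap.bilinearComp_apply]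
  exact metricAt_comm (E := E) _ _ _

theorem metricAt_differential [IsManifold 𝓘(ℝ, E) ∞ M] {X : Type*} [NormedAddCommGroup X]
    [NormedSpace ℝ X] {G : X → M} {x : X} {e : OpenPartialHomeomorph M E} (he : e ∈ atlas E M)
    (hG : MDifferentiableAt 𝓘(ℝ, X) 𝓘(ℝ, E) G x) (hx : G x ∈ e.source) (a b : X) :
    metricAt (E := E) (G x) (differential (E := E) G x a) (differential (E := E) G x b)
      = chartMetricL e (e (G x)) (fderiv ℝ (fun y => e (G y)) x a)
        (fderiv ℝ (fun y => e (G y)) x b) := by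
  rw [differential_eq_comp_symm he hG hx]
  simp only [chartMetricL, e.left_inv hx]
  rfl

/-- The vector fields being paired are images of constant fields under the tangent map of the
inverse chart, hence smooth; the metric of two smooth fields is smooth. -/
theorem contDiffOn_chartMetric [IsManifold 𝓘(ℝ, E) ∞ M]
    [IsContMDiffRiemannianBundle 𝓘(ℝ, E) ∞ E (fun x : M => TangentSpace 𝓘(ℝ, E) x)]
    {e : OpenPartialHomeomorph M E} (he : e ∈ atlas E M) (a b : E) :
    ContDiffOn ℝ ∞ (fun z => chartMetric e z a b) e.target := by
  have hm : IsManifold 𝓘(ℝ, E) (∞ + 1) M := inferInstanceAs (IsManifold 𝓘(ℝ, E) ∞ M)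
  have htan := (contMDiffOn_symm_of_mem_maximalAtlas (n := ∞)
    (IsManifold.subset_maximalAtlas (I := 𝓘(ℝ, E)) he)).contMDiffOn_tangentMapWithin
    (m := ∞) le_rfl e.open_target.uniqueMDiffOn
  have hsec : ∀ c : E, ContMDiffOn 𝓘(ℝ, E) (𝓘(ℝ, E).prod 𝓘(ℝ, E)) ∞
      (fun z => (⟨e.symm z, mfderiv 𝓘(ℝ, E) 𝓘(ℝ, E) e.symm z c⟩ : TangentBundle 𝓘(ℝ, E) M))
      e.target := by
    intro c
    have hconst : ContMDiffOn 𝓘(ℝ, E) 𝓘(ℝ, E).tangent ∞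
        (fun z : E => (⟨z, c⟩ : TangentBundle 𝓘(ℝ, E) E)) e.target :=
      contMDiffOn_vectorSpace_iff_contDiffOn.mpr contDiffOn_const
    refine (htan.comp hconst fun z hz => hz).congr fun z hz => ?_
    simp only [Function.comp_apply, tangentMapWithin]
    rw [mfderivWithin_of_isOpen e.open_target hz]
  rw [← contMDiffOn_iff_contDiffOn]
  exact ContMDiffOn.inner_bundle (E := fun x : M => TangentSpace 𝓘(ℝ, E) x) (IB := 𝓘(ℝ, E))
    (b := e.symm) (v := fun z => mfderiv 𝓘(ℝ, E) 𝓘(ℝ, E) e.symm z a)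
    (w := fun z => mfderiv 𝓘(ℝ, E) 𝓘(ℝ, E) e.symm z b) (hsec a) (hsec b)

/-- In finite dimension, smoothness of an operator-valued map can be tested on vectors. -/
theorem contDiffOn_chartMetricL [FiniteDimensional ℝ E] [IsManifold 𝓘(ℝ, E) ∞ M]
    [IsContMDiffRiemannianBundle 𝓘(ℝ, E) ∞ E (fun x : M => TangentSpace 𝓘(ℝ, E) x)]
    {e : OpenPartialHomeomorph M E} (he : e ∈ atlas E M) :
    ContDiffOn ℝ ∞ (chartMetricL e) e.target :=
  contDiffOn_clm_apply.mpr fun a => contDiffOn_clm_apply.mpr fun b =>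
    (contDiffOn_chartMetric he a b).congr fun z _ => chartMetricL_apply e z a b

end Metric


/-! ### First variation of one smooth segment -/

section Segment

variable {E : Type*} [NormedAddCommGroup E] [NormedSpace ℝ E]
  {M : Type*} [TopologicalSpace M] [ChartedSpace E M] [IsManifold 𝓘(ℝ, E) ∞ M]

theorem contDiffAt_chart_comp {X : Type*} [NormedAddCommGroup X] [NormedSpace ℝ X] {G : X → M}
    {x : X} (hG : ContMDiffAt 𝓘(ℝ, X) 𝓘(ℝ, E) 2 G x) {e : OpenPartialHomeomorph M E}
    (he : e ∈ atlas E M) (hx : G x ∈ e.source) : ContDiffAt ℝ 2 (fun y => e (G y)) x := by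
  have hm : IsManifold 𝓘(ℝ, E) 2 M := inferInstance
  rw [← contMDiffAt_iff_contDiffAt]
  exact (contMDiffAt_of_mem_maximalAtlas (n := 2) (IsManifold.subset_maximalAtlas he) hx).comp x hG

variable [RiemannianBundle (fun x : M => TangentSpace 𝓘(ℝ, E) x)]
  {F : Type*} [NormedAddCommGroup F] [NormedSpace ℝ F]

/-- One fixed chart serves a whole neighbourhood, so that both sides may be differentiated. -/
theorem eventually_metricAt_eq {X : Type*} [NormedAddCommGroup X] [NormedSpace ℝ X] {G : X → M}
    {x : X} (hG : ContMDiffAt 𝓘(ℝ, X) 𝓘(ℝ, E) 2 G x) {e : OpenPartialHomeomorph M E}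
    (he : e ∈ atlas E M) (hx : G x ∈ e.source) :
    ∀ᶠ y in 𝓝 x, ∀ a b, metricAt (E := E) (G y) (differential (E := E) G y a)
      (differential (E := E) G y b) = chartMetricL e (e (G y)) (fderiv ℝ (fun y => e (G y)) y a)
        (fderiv ℝ (fun y => e (G y)) y b) := by
  have hm : IsManifold 𝓘(ℝ, E) 2 M := inferInstance
  filter_upwards [contMDiffAt_iff_contMDiffAt_nhds (by simp) |>.mp hG,
    hG.continuousAt (e.open_source.mem_nhds hx)] with y hy hys
  exact metricAt_differential he (hy.mdifferentiableAt (by simp)) hys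


variable (E) in
/-- The squared speed `g(∂ₛG, ∂ₛG)` of a family of curves `s ↦ G (p, s)`. -/
def energy (G : F × ℝ → M) (x : F × ℝ) : ℝ :=
  metricAt (E := E) (G x) (differential (E := E) G x (0, 1)) (differential (E := E) G x (0, 1))

variable (E) in
/-- The linear form `v ↦ g(∂ₛG, ∂ᵥG)`. -/
def pairing (G : F × ℝ → M) (x : F × ℝ) : F →L[ℝ] ℝ :=
  (metricAt (E := E) (G x) (differential (E := E) G x (0, 1))).comp
    ((differential (E := E) G x).comp (ContinuousLinearMap.inl ℝ F ℝ))

theorem eventually_pairing_eq {G : F × ℝ → M} {x : F × ℝ}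
    (hG : ContMDiffAt 𝓘(ℝ, F × ℝ) 𝓘(ℝ, E) 2 G x) {e : OpenPartialHomeomorph M E}
    (he : e ∈ atlas E M) (hx : G x ∈ e.source) :
    pairing E G =ᶠ[𝓝 x] fun y =>
      (chartMetricL e (e (G y)) (fderiv ℝ (fun y => e (G y)) y (0, 1))).comp
        ((fderiv ℝ (fun y => e (G y)) y).comp (ContinuousLinearMap.inl ℝ F ℝ)) := by
  filter_upwards [eventually_metricAt_eq hG he hx] with y hy
  ext v
  exact hy _ _

variable [FiniteDimensional ℝ E]
  [IsContMDiffRiemannianBundle 𝓘(ℝ, E) ∞ E (fun x : M => TangentSpace 𝓘(ℝ, E) x)]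

theorem contDiffAt_chartMetricL {e : OpenPartialHomeomorph M E} (he : e ∈ atlas E M) {z : E}
    (hz : z ∈ e.target) : ContDiffAt ℝ 1 (chartMetricL e) z :=
  ((contDiffOn_chartMetricL he).contDiffAt (e.open_target.mem_nhds hz)).of_le (by simp)

theorem contDiffAt_energy {G : F × ℝ → M} {x : F × ℝ}
    (hG : ContMDiffAt 𝓘(ℝ, F × ℝ) 𝓘(ℝ, E) 2 G x) : ContDiffAt ℝ 1 (energy E G) x := by
  have he := chart_mem_atlas E (G x)
  have hx := mem_chart_source E (G x)
  have hu := contDiffAt_chart_comp hG he hx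
  have hg := ContDiffAt.comp x (contDiffAt_chartMetricL he ((chartAt E (G x)).map_source hx))
    (hu.of_le one_le_two)
  have hV : ContDiffAt ℝ 1 (fun y => fderiv ℝ (fun y => chartAt E (G x) (G y)) y (0, 1)) x :=
    (hu.fderiv_right (m := 1) (by norm_num)).clm_apply contDiffAt_const
  refine ((hg.clm_apply hV).clm_apply hV).congr_of_eventuallyEq ?_
  filter_upwards [eventually_metricAt_eq hG he hx] with y hy using hy _ _

theorem continuousAt_pairing {G : F × ℝ → M} {x : F × ℝ}
    (hG : ContMDiffAt 𝓘(ℝ, F × ℝ) 𝓘(ℝ, E) 2 G x) : ContinuousAt (pairing E G) x := by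
  have he := chart_mem_atlas E (G x)
  have hx := mem_chart_source E (G x)
  have hu := contDiffAt_chart_comp hG he hx
  have hg := ContDiffAt.comp x (contDiffAt_chartMetricL he ((chartAt E (G x)).map_source hx))
    (hu.of_le one_le_two)
  have hD := hu.fderiv_right (m := 1) (by norm_num)
  exact (((hg.clm_apply (hD.clm_apply contDiffAt_const)).clm_comp
    (hD.clm_comp contDiffAt_const)).continuousAt).congr (eventually_pairing_eq hG he hx).symm

theorem hasDerivAt_pairing {G : F × ℝ → M} {p₀ : F} {s : ℝ}
    (hG : ContMDiffAt 𝓘(ℝ, F × ℝ) 𝓘(ℝ, E) 2 G (p₀, s))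
    (hgeo : ∀ e ∈ atlas E M, G (p₀, s) ∈ e.source → ∀ w : E,
      chartCovAcc e (fun r => e (G (p₀, r))) s w = 0) :
    HasDerivAt (fun r => pairing E G (p₀, r))
      ((1 / 2 : ℝ) • (fderiv ℝ (energy E G) (p₀, s)).comp (ContinuousLinearMap.inl ℝ F ℝ)) s := by
  have he := chart_mem_atlas E (G (p₀, s))
  have hx := mem_chart_source E (G (p₀, s))
  set e := chartAt E (G (p₀, s))
  have hu := contDiffAt_chart_comp hG he hx
  have hg : DifferentiableAt ℝ (chartMetricL e) (e (G (p₀, s))) :=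
    (contDiffAt_chartMetricL he (e.map_source hx)).differentiableAt (by simp)
  -- `chartCovAcc` differentiates scalar functions, the vector space computation a form-valued one;
  -- evaluation on `a`, `b` commutes with the derivative.
  have hfd : ∀ a b w : E, fderiv ℝ (fun z => chartMetric e z a b) (e (G (p₀, s))) w
      = fderiv ℝ (chartMetricL e) (e (G (p₀, s))) w a b := by
    intro a b w
    have h := (hg.hasFDerivAt.clm_apply (hasFDerivAt_const a _)).clm_apply (hasFDerivAt_const b _)
    have h' := h.fderiv
    simp only [chartMetricL_apply] at h'
    rw [h']
    simp
  have key := hasDerivAt_metric_pairing (g := chartMetricL e) hu hg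
    (fun a b => chartMetricL_comm e _ a b) (fun w => by
      have := hgeo e he hx w
      simpa only [← hfd, chartMetricL_apply, chartCovAcc] using this)
  have hen : energy E G =ᶠ[𝓝 (p₀, s)] fun y =>
      chartMetricL e (e (G y)) (fderiv ℝ (fun y => e (G y)) y (0, 1))
        (fderiv ℝ (fun y => e (G y)) y (0, 1)) := by
    filter_upwards [eventually_metricAt_eq hG he hx] with y hy using hy _ _
  rw [hen.fderiv_eq]
  refine key.congr_of_eventuallyEq ?_
  have ht : Tendsto (fun r : ℝ => ((p₀, r) : F × ℝ)) (𝓝 s) (𝓝 (p₀, s)) :=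
    (by fun_prop : Continuous fun r : ℝ => ((p₀, r) : F × ℝ)).tendsto s
  exact ht.eventually (eventually_pairing_eq hG he hx)

/-- First variation of the length of one smooth segment: only boundary terms remain if the curve at
the base parameter is a unit speed geodesic. -/
theorem hasFDerivAt_integral_speed {G : F × ℝ → M} {p₀ : F} {τ₀ τ₁ : F → ℝ}
    (h₀ : DifferentiableAt ℝ τ₀ p₀) (h₁ : DifferentiableAt ℝ τ₁ p₀) (hle : τ₀ p₀ ≤ τ₁ p₀)
    (hG : ∀ s ∈ Icc (τ₀ p₀) (τ₁ p₀), ContMDiffAt 𝓘(ℝ, F × ℝ) 𝓘(ℝ, E) 2 G (p₀, s))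
    (hone : ∀ s ∈ Icc (τ₀ p₀) (τ₁ p₀), energy E G (p₀, s) = 1)
    (hgeo : ∀ s ∈ Ioo (τ₀ p₀) (τ₁ p₀), ∀ e ∈ atlas E M, G (p₀, s) ∈ e.source → ∀ w : E,
      chartCovAcc e (fun r => e (G (p₀, r))) s w = 0) :
    HasFDerivAt (fun p => ∫ s in τ₀ p..τ₁ p, √(energy E G (p, s)))
      ((metricAt (E := E) (G (p₀, τ₁ p₀)) (differential (E := E) G (p₀, τ₁ p₀) (0, 1))).comp
          (differential (E := E) (fun p => G (p, τ₁ p)) p₀)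
        - (metricAt (E := E) (G (p₀, τ₀ p₀)) (differential (E := E) G (p₀, τ₀ p₀) (0, 1))).comp
          (differential (E := E) (fun p => G (p, τ₀ p)) p₀)) p₀ := by
  have hend : ∀ τ : F → ℝ, DifferentiableAt ℝ τ p₀ → τ p₀ ∈ Icc (τ₀ p₀) (τ₁ p₀) →
      (metricAt (E := E) (G (p₀, τ p₀)) (differential (E := E) G (p₀, τ p₀) (0, 1))).comp
        (differential (E := E) (fun p => G (p, τ p)) p₀)
        = pairing E G (p₀, τ p₀) + fderiv ℝ τ p₀ := by
    intro τ hτ hmem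
    have hd : HasFDerivAt (fun p => (p, τ p))
        ((ContinuousLinearMap.id ℝ F).prod (fderiv ℝ τ p₀)) p₀ :=
      (hasFDerivAt_id p₀).prodMk hτ.hasFDerivAt
    have hcomp : differential (E := E) (fun p => G (p, τ p)) p₀ =
        (differential (E := E) G (p₀, τ p₀)).comp
          ((ContinuousLinearMap.id ℝ F).prod (fderiv ℝ τ p₀)) :=
      (HasMFDerivAt.comp p₀ ((hG _ hmem).mdifferentiableAt (by simp)).hasMFDerivAt
        hd.hasMFDerivAt).mfderiv
    rw [hcomp]
    ext v
    -- The time component of the motion pairs with `∂ₛG` to `energy * dτ = dτ`, by unit speed.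
    have hv : ((v, fderiv ℝ τ p₀ v) : F × ℝ) = (v, 0) + (fderiv ℝ τ p₀ v) • (0, 1) := by simp
    have h1 := hone _ hmem
    simp only [energy] at h1
    simp [pairing, hv, -Prod.mk_add_mk, -Prod.smul_mk, h1]
  rw [hend τ₁ h₁ (right_mem_Icc.mpr hle), hend τ₀ h₀ (left_mem_Icc.mpr hle)]
  refine hasFDerivAt_integral_moving (f := fun x => √(energy E G x)) h₀.hasFDerivAt h₁.hasFDerivAt
    hle (fun s hs => ?_)
    (fun s hs => ?_) (B := fun r => pairing E G (p₀, r)) (fun s hs => ?_) (fun s hs => ?_)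
  · exact (contDiffAt_energy (hG s hs)).sqrt (by rw [hone s hs]; exact one_ne_zero)
  · rw [hone s hs, Real.sqrt_one]
  · exact ((continuousAt_pairing (hG s hs)).comp (f := fun r : ℝ => ((p₀, r) : F × ℝ))
      (by fun_prop)).continuousWithinAt
  · have hs' := Ioo_subset_Icc_self hs
    have hen := (contDiffAt_energy (hG s hs')).differentiableAt (by simp)
    have := (hen.hasFDerivAt.sqrt (by rw [hone s hs']; exact one_ne_zero)).fderiv
    rw [this, hone s hs', Real.sqrt_one]
    convert hasDerivAt_pairing (hG s hs') (hgeo s hs) using 1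
    ext v
    simp

end Segment


/-! ### Covectors vanishing to first order along a set, and the reflection law -/

section Null

variable {E : Type*} [NormedAddCommGroup E] [NormedSpace ℝ E]
  {M : Type*} [TopologicalSpace M] [ChartedSpace E M]
  {F : Type*} [NormedAddCommGroup F] [NormedSpace ℝ F]

/-- Two derivatives of the same map along a set differ by a linear map which is `o(|p - p₀|)` along
the set. -/
theorem hasFDerivWithinAt_zero_of_hasMFDerivWithinAt {φ ψ : F → M} {A : Set F} {p₀ : F}
    (hp₀ : p₀ ∈ A) {D D' : F →L[ℝ] E} (hφ : HasMFDerivWithinAt 𝓘(ℝ, F) 𝓘(ℝ, E) φ A p₀ D)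
    (hψ : HasMFDerivWithinAt 𝓘(ℝ, F) 𝓘(ℝ, E) ψ A p₀ D') (h : φ =ᶠ[𝓝[A] p₀] ψ) :
    HasFDerivWithinAt (fun _ => (0 : E)) (D - D') A p₀ := by
  have hψ' : HasMFDerivWithinAt 𝓘(ℝ, F) 𝓘(ℝ, E) φ A p₀ D' :=
    hψ.congr_of_eventuallyEq h (h.self_of_nhdsWithin hp₀)
  have h1 := hφ.2
  have h2 := hψ'.2
  simp only [mfld_simps] at h1 h2
  exact (h1.sub h2).congr_of_eventuallyEq (Eventually.of_forall fun p => (sub_self _).symm)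
    (sub_self _).symm

/-- Where `ρ < 0`, continuity keeps `ρ ≤ 0` nearby, so the point is interior to `K`. -/
theorem eventually_frontier_eq_zero [IsManifold 𝓘(ℝ, E) ∞ M] {K : Set M} (hK : IsClosed K)
    {ρ : M → ℝ} {q : M} (hρ : IsDefiningFunctionAt (E := E) K ρ q) :
    ∀ᶠ z in 𝓝 q, z ∈ frontier K → ρ z = 0 := by
  have hm : IsManifold 𝓘(ℝ, E) 1 M := inferInstance
  have h1 : ContMDiffAt 𝓘(ℝ, E) 𝓘(ℝ, ℝ) 1 ρ q := hρ.1.of_le (by simp)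
  filter_upwards [(contMDiffAt_iff_contMDiffAt_nhds (by simp)).mp h1, hρ.2.2.2.eventually_nhds]
    with z hz hzK hzf
  have hle : ρ z ≤ 0 := hzK.self_of_nhds.mp (hK.frontier_subset hzf)
  refine hle.antisymm (not_lt.mp fun hlt => hzf.2 ?_)
  rw [mem_interior_iff_mem_nhds]
  filter_upwards [hzK, hz.continuousAt.eventually (gt_mem_nhds hlt)] with w hw hlw
  exact hw.mpr hlw.le

theorem exists_eq_smul_of_ker_le {V : Type*} [NormedAddCommGroup V] [NormedSpace ℝ V]
    {ℓ ρ : V →L[ℝ] ℝ} (hρ : ρ ≠ 0) (h : ∀ v, ρ v = 0 → ℓ v = 0) : ∃ c : ℝ, ℓ = c • ρ := by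
  obtain ⟨v, hv⟩ : ∃ v, ρ v ≠ 0 := by
    by_contra! hcon
    exact hρ (ContinuousLinearMap.ext hcon)
  refine ⟨ℓ v / ρ v, ContinuousLinearMap.ext fun w => ?_⟩
  have := h (w - (ρ w / ρ v) • v) (by simp [hv])
  simp only [map_sub, map_smul, smul_eq_mul] at this
  simp only [smul_apply, smul_eq_mul]
  linear_combination this

/-- A covector which vanishes on the vectors tangent to `∂K` kills, to first order along `A`, the
motion of a point of `∂K`. -/
theorem hasFDerivWithinAt_zero_of_mem_frontier [IsManifold 𝓘(ℝ, E) ∞ M] {K : Set M}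
    (hK : IsSmoothDomain E K) {φ : F → M} {A : Set F} {p₀ : F} (hp₀ : p₀ ∈ A) {D : F →L[ℝ] E}
    (hφ : HasMFDerivWithinAt 𝓘(ℝ, F) 𝓘(ℝ, E) φ A p₀ D)
    (hfr : ∀ᶠ p in 𝓝[A] p₀, φ p ∈ frontier K) {ℓ : E →L[ℝ] ℝ}
    (hℓ : ∀ v : TangentSpace 𝓘(ℝ, E) (φ p₀), IsTangentToBoundary K (φ p₀) v → ℓ v = 0) :
    HasFDerivWithinAt (fun _ => (0 : ℝ)) (ℓ.comp D) A p₀ := by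
  obtain ⟨ρ, hρ⟩ := hK.2 _ (hfr.self_of_nhdsWithin hp₀)
  have hd : HasMFDerivAt 𝓘(ℝ, E) 𝓘(ℝ, ℝ) ρ (φ p₀) _ :=
    (hρ.1.mdifferentiableAt (by simp)).hasMFDerivAt
  let dρ : E →L[ℝ] ℝ := mfderiv 𝓘(ℝ, E) 𝓘(ℝ, ℝ) ρ (φ p₀)
  obtain ⟨c, hc⟩ := exists_eq_smul_of_ker_le (ℓ := ℓ) (ρ := dρ) hρ.2.1
    fun v hv => hℓ v ⟨ρ, hρ, hv⟩
  have hcomp : HasFDerivWithinAt (ρ ∘ φ) (dρ.comp D) A p₀ :=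
    (hd.comp_hasMFDerivWithinAt p₀ hφ).hasFDerivWithinAt
  have hz : (fun _ => (0 : ℝ)) =ᶠ[𝓝[A] p₀] ρ ∘ φ := by
    filter_upwards [hfr, hφ.1.eventually (eventually_frontier_eq_zero hK.1 hρ)] with p hp hp'
    exact (hp' hp).symm
  have h0 := (hcomp.congr_of_eventuallyEq hz (hz.self_of_nhdsWithin hp₀)).const_smul c
  rw [hc]
  simpa [Pi.smul_def] using h0

/-- Telescoping of boundary terms which match up to `o(|p - p₀|)` along `A`. -/
theorem hasFDerivWithinAt_sum_telescope {f : ℕ → F → ℝ} {α β : ℕ → F →L[ℝ] ℝ} {A : Set F} {p₀ : F}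
    {n : ℕ} (hn : 0 < n) (hf : ∀ i < n, HasFDerivWithinAt (f i) (α i - β i) A p₀)
    (hmid : ∀ i, i + 1 < n → HasFDerivWithinAt (fun _ => (0 : ℝ)) (α i - β (i + 1)) A p₀)
    (hend : ∀ i, i + 1 = n → HasFDerivWithinAt (fun _ => (0 : ℝ)) (α i) A p₀) :
    HasFDerivWithinAt (fun p => ∑ i ∈ Finset.range n, f i p) (-β 0) A p₀ := by
  -- Setting the term at index `n` to zero lets the fixed end point be treated like an interior
  -- division point.
  let β' : ℕ → F →L[ℝ] ℝ := fun i => if i < n then β i else 0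
  have h1 := HasFDerivWithinAt.fun_sum (u := Finset.range n)
    fun i hi => hf i (Finset.mem_range.mp hi)
  have h2 := HasFDerivWithinAt.fun_sum (u := Finset.range n) (A := fun _ _ => (0 : ℝ))
    (A' := fun i => α i - β' (i + 1)) (s := A) (x := p₀) (𝕜 := ℝ) fun i hi => by
      rcases (Nat.succ_le_of_lt (Finset.mem_range.mp hi)).lt_or_eq with h | h
      · simpa [β', show i + 1 < n from h] using hmid i h
      · simpa [β', show i + 1 = n from h] using hend i h
  have hsum : ∑ i ∈ Finset.range n, (α i - β i) - ∑ i ∈ Finset.range n, (α i - β' (i + 1))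
      = -β 0 := by
    have : ∀ i ∈ Finset.range n, (α i - β i) - (α i - β' (i + 1)) = β' (i + 1) - β' i := by
      intro i hi
      simp only [β', if_pos (Finset.mem_range.mp hi)]
      abel
    rw [← Finset.sum_sub_distrib, Finset.sum_congr rfl this, Finset.sum_range_sub]
    simp [β', hn]
  rw [← hsum]
  refine (h1.sub h2).congr_of_eventuallyEq (Eventually.of_forall fun p => ?_) ?_ <;> simp

end Null

/-! ### One-sided velocities and length in terms of the smooth extensions -/

section Length

variable {E : Type*} [NormedAddCommGroup E] [NormedSpace ℝ E]
  {M : Type*} [TopologicalSpace M] [ChartedSpace E M]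
  {F : Type*} [NormedAddCommGroup F] [NormedSpace ℝ F]

theorem mfderiv_slice {G : F × ℝ → M} {p : F} {s : ℝ}
    (hG : MDifferentiableAt 𝓘(ℝ, F × ℝ) 𝓘(ℝ, E) G (p, s)) :
    HasMFDerivAt 𝓘(ℝ, ℝ) 𝓘(ℝ, E) (fun r => G (p, r)) s
      ((differential (E := E) G (p, s)).comp (ContinuousLinearMap.inr ℝ F ℝ)) :=
  hG.hasMFDerivAt.comp (f := fun r : ℝ => (p, r)) s (hasFDerivAt_prodMk_right p s).hasMFDerivAt

theorem velRight_eq {γ : ℝ → M} {G : F × ℝ → M} {p : F} {a b s : ℝ}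
    (hG : MDifferentiableAt 𝓘(ℝ, F × ℝ) 𝓘(ℝ, E) G (p, s))
    (h : ∀ r ∈ Icc a b, γ r = G (p, r)) (hs : s ∈ Ico a b) :
    velRight E γ s = differential (E := E) G (p, s) (0, 1) := by
  have hev : γ =ᶠ[𝓝[Ici s] s] fun r => G (p, r) := by
    filter_upwards [Icc_mem_nhdsGE hs.2] with r hr using h r ⟨hs.1.trans hr.1, hr.2⟩
  have huniq : UniqueMDiffWithinAt 𝓘(ℝ, ℝ) (Ici s) s :=
    uniqueMDiffWithinAt_iff_uniqueDiffWithinAt.mpr (uniqueDiffWithinAt_Ici s)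
  have hd : HasMFDerivWithinAt 𝓘(ℝ, ℝ) 𝓘(ℝ, E) γ (Ici s) s
      ((differential (E := E) G (p, s)).comp (ContinuousLinearMap.inr ℝ F ℝ)) :=
    (mfderiv_slice hG).hasMFDerivWithinAt.congr_of_eventuallyEq hev
      (h s ⟨hs.1, hs.2.le⟩)
  exact congrArg (fun L : ℝ →L[ℝ] E => L 1) (hd.mfderivWithin huniq)

theorem velLeft_eq {γ : ℝ → M} {G : F × ℝ → M} {p : F} {a b s : ℝ}
    (hG : MDifferentiableAt 𝓘(ℝ, F × ℝ) 𝓘(ℝ, E) G (p, s))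
    (h : ∀ r ∈ Icc a b, γ r = G (p, r)) (hs : s ∈ Ioc a b) :
    velLeft E γ s = differential (E := E) G (p, s) (0, 1) := by
  have hev : γ =ᶠ[𝓝[Iic s] s] fun r => G (p, r) := by
    filter_upwards [Icc_mem_nhdsLE hs.1] with r hr using h r ⟨hr.1, hr.2.trans hs.2⟩
  have huniq : UniqueMDiffWithinAt 𝓘(ℝ, ℝ) (Iic s) s :=
    uniqueMDiffWithinAt_iff_uniqueDiffWithinAt.mpr (uniqueDiffWithinAt_Iic s)
  have hd : HasMFDerivWithinAt 𝓘(ℝ, ℝ) 𝓘(ℝ, E) γ (Iic s) s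
      ((differential (E := E) G (p, s)).comp (ContinuousLinearMap.inr ℝ F ℝ)) :=
    (mfderiv_slice hG).hasMFDerivWithinAt.congr_of_eventuallyEq hev
      (h s ⟨hs.1.le, hs.2⟩)
  exact congrArg (fun L : ℝ →L[ℝ] E => L 1) (hd.mfderivWithin huniq)

variable [RiemannianBundle (fun x : M => TangentSpace 𝓘(ℝ, E) x)]

theorem chartCovAcc_congr {e : OpenPartialHomeomorph M E} {u v : ℝ → E} {t : ℝ}
    (h : u =ᶠ[𝓝 t] v) (w : E) : chartCovAcc e u t w = chartCovAcc e v t w := by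
  simp only [chartCovAcc, h.deriv.deriv_eq, h.deriv_eq, h.self_of_nhds]

theorem enorm_mfderiv_slice {G : F × ℝ → M} {p : F} {s : ℝ}
    (hG : MDifferentiableAt 𝓘(ℝ, F × ℝ) 𝓘(ℝ, E) G (p, s)) :
    ‖mfderiv 𝓘(ℝ, ℝ) 𝓘(ℝ, E) (fun r => G (p, r)) s (1 : ℝ)‖ₑ
      = ENNReal.ofReal √(energy E G (p, s)) := by
  rw [← ofReal_norm, norm_eq_sqrt_real_inner, (mfderiv_slice hG).mfderiv]
  rfl

theorem pathELength_eq_ofReal_integral [FiniteDimensional ℝ E] [IsManifold 𝓘(ℝ, E) ∞ M]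
    [IsContMDiffRiemannianBundle 𝓘(ℝ, E) ∞ E (fun x : M => TangentSpace 𝓘(ℝ, E) x)]
    {γ : ℝ → M} {G : F × ℝ → M} {p : F} {a b : ℝ} (hab : a ≤ b)
    (hG : ∀ s ∈ Icc a b, ContMDiffAt 𝓘(ℝ, F × ℝ) 𝓘(ℝ, E) 2 G (p, s))
    (h : ∀ r ∈ Icc a b, γ r = G (p, r)) :
    pathELength 𝓘(ℝ, E) γ a b = ENNReal.ofReal (∫ s in a..b, √(energy E G (p, s))) := by
  rw [pathELength_congr (γ' := fun r => G (p, r)) h, pathELength_eq_lintegral_mfderiv_Icc,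
    intervalIntegral.integral_of_le hab, ← integral_Icc_eq_integral_Ioc,
    ofReal_integral_eq_lintegral_ofReal]
  · exact setLIntegral_congr_fun measurableSet_Icc fun s hs =>
      enorm_mfderiv_slice ((hG s hs).mdifferentiableAt (by simp))
  · refine ContinuousOn.integrableOn_Icc fun s hs => ?_
    exact (((contDiffAt_energy (hG s hs)).continuousAt.comp
      (f := fun r : ℝ => ((p, r) : F × ℝ)) (by fun_prop)).sqrt).continuousWithinAt
  · exact Eventually.of_forall fun s => Real.sqrt_nonneg _

end Length


/-! ### First variation of a generalised geodesic -/

section FirstVariation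

/-- The moving interval is covered by the fixed compact one and two short intervals at its ends. -/
theorem eventually_forall_Icc_of_moving {F : Type*} [TopologicalSpace F] {p₀ : F} {τ₀ τ₁ : F → ℝ}
    (h₀ : ContinuousAt τ₀ p₀) (h₁ : ContinuousAt τ₁ p₀) (hle : τ₀ p₀ ≤ τ₁ p₀) {Q : F × ℝ → Prop}
    (hQ : ∀ s ∈ Icc (τ₀ p₀) (τ₁ p₀), ∀ᶠ x in 𝓝 (p₀, s), Q x) :
    ∀ᶠ p in 𝓝 p₀, ∀ s ∈ Icc (τ₀ p) (τ₁ p), Q (p, s) := by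
  have hmid : ∀ᶠ p in 𝓝 p₀, ∀ s ∈ Icc (τ₀ p₀) (τ₁ p₀), Q (p, s) :=
    isCompact_Icc.eventually_forall_of_forall_eventually hQ
  filter_upwards [hmid, eventually_uIcc_of_continuousAt h₀ (hQ _ (left_mem_Icc.mpr hle)),
    eventually_uIcc_of_continuousAt h₁ (hQ _ (right_mem_Icc.mpr hle))] with p hm hl hr s hs
  rcases lt_or_ge s (τ₀ p₀) with h | h
  · exact hl s (mem_uIcc.mpr (Or.inr ⟨hs.1, h.le⟩))
  · rcases lt_or_ge (τ₁ p₀) s with h' | h'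
    · exact hr s (mem_uIcc.mpr (Or.inl ⟨h'.le, hs.2⟩))
    · exact hm s ⟨h, h'⟩

theorem division_le {t : ℕ → ℝ} {n : ℕ} (h : ∀ i < n, t i ≤ t (i + 1)) {i j : ℕ} (hij : i ≤ j)
    (hj : j ≤ n) : t i ≤ t j := by
  induction j, hij using Nat.le_induction with
  | base => exact le_rfl
  | succ k _ ih => exact (ih (by omega)).trans (h k (by omega))

variable {E : Type*} [NormedAddCommGroup E] [NormedSpace ℝ E]
  {M : Type*} [TopologicalSpace M] [ChartedSpace E M]
  [RiemannianBundle (fun x : M => TangentSpace 𝓘(ℝ, E) x)]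
  {F : Type*} [NormedAddCommGroup F] [NormedSpace ℝ F]

theorem pathELength_eq_sum {γ : ℝ → M} {t : ℕ → ℝ} {n : ℕ} (h : ∀ i < n, t i ≤ t (i + 1)) :
    pathELength 𝓘(ℝ, E) γ (t 0) (t n)
      = ∑ i ∈ Finset.range n, pathELength 𝓘(ℝ, E) γ (t i) (t (i + 1)) := by
  induction n with
  | zero => simp
  | succ k ih =>
    rw [Finset.sum_range_succ, ← ih fun i hi => h i (by omega),
      pathELength_add (division_le h (Nat.zero_le k) (by omega)) (h k (by omega))]

theorem energy_eq_one [IsManifold 𝓘(ℝ, E) ∞ M] {K S : Set M} {γ : ℝ → M} {n : ℕ} {t : ℕ → ℝ}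
    (hγ : IsGenGeodesic E K S γ n t) {i : ℕ} (hi : i < n) {G : F × ℝ → M} {p : F}
    (hG : ∀ s ∈ Icc (t i) (t (i + 1)), MDifferentiableAt 𝓘(ℝ, F × ℝ) 𝓘(ℝ, E) G (p, s))
    (h : ∀ s ∈ Icc (t i) (t (i + 1)), γ s = G (p, s)) {s : ℝ} (hs : s ∈ Icc (t i) (t (i + 1))) :
    energy E G (p, s) = 1 := by
  have key : ∀ v : TangentSpace 𝓘(ℝ, E) (γ s), ‖v‖ = 1 →
      v = (differential (E := E) G (p, s) (0, 1) : E) → energy E G (p, s) = 1 := by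
    intro v hv hvd
    have h1 : metricAt (E := E) (γ s) v v = 1 := by
      rw [metricAt_apply, real_inner_self_eq_norm_sq, hv, one_pow]
    rw [hvd, h s hs] at h1
    exact h1
  rcases hs.2.lt_or_eq with hlt | heq
  · exact key _ (hγ.unit_right i hi s ⟨hs.1, hlt⟩) (velRight_eq (hG s hs) h ⟨hs.1, hlt⟩)
  · have hs' : s ∈ Ioc (t i) (t (i + 1)) := ⟨heq ▸ hγ.lt i hi, hs.2⟩
    exact key _ (hγ.unit_left i hi s hs') (velLeft_eq (hG s hs) h hs')

/-- First variation of the length of a generalised geodesic, for variations parametrized by a subset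
of a normed space. -/
theorem hasFDerivWithinAt_curveLength [FiniteDimensional ℝ E] [IsManifold 𝓘(ℝ, E) ∞ M]
    [IsContMDiffRiemannianBundle 𝓘(ℝ, E) ∞ E (fun x : M => TangentSpace 𝓘(ℝ, E) x)]
    {K S : Set M} (hK : IsSmoothDomain E K) {γ : ℝ → M} {n : ℕ} {t : ℕ → ℝ}
    (hγ : IsGenGeodesic E K S γ n t) {A : Set F} {p₀ : F} {Γ : F → ℝ → M} {τ : ℕ → F → ℝ}
    (hV : IsVariation (E := E) (F := F) K γ n t A p₀ Γ τ) :
    ∃ D : F →L[ℝ] E,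
      HasMFDerivWithinAt 𝓘(ℝ, F) 𝓘(ℝ, E) (fun p => Γ p (τ 0 p)) A p₀ D ∧
      HasFDerivWithinAt (fun p => curveLength E (Γ p) (τ 0 p) (τ n p))
        (-(metricAt (E := E) (γ (t 0)) (velRight E γ (t 0))).comp D) A p₀ := by
  have hp₀ := hV.mem
  have : Nonempty M := ⟨γ 0⟩
  have hτd : ∀ i ≤ n, DifferentiableAt ℝ (τ i) p₀ := fun i hi =>
    ((contMDiffAt_iff_contDiffAt.mp (hV.time_smooth i hi)).differentiableAt (by simp))
  choose! G hGs hGe using hV.segment_smooth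
  -- Order `2` makes the energy `C¹`; being finite, it also propagates to nearby points, as used in
  -- `hlen`.
  have hG : ∀ i < n, ∀ s ∈ Icc (t i) (t (i + 1)),
      ContMDiffAt 𝓘(ℝ, F × ℝ) 𝓘(ℝ, E) 2 (G i) (p₀, s) := by
    intro i hi s hs
    have h : ContMDiffAt (𝓘(ℝ, F).prod 𝓘(ℝ, ℝ)) 𝓘(ℝ, E) 2 (G i) (p₀, s) :=
      (hGs i hi s hs).of_le ENat.LEInfty.out
    rwa [modelWithCornersSelf_prod, ← chartedSpaceSelf_prod]
  have hGm : ∀ i < n, ∀ s ∈ Icc (t i) (t (i + 1)),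
      MDifferentiableAt 𝓘(ℝ, F × ℝ) 𝓘(ℝ, E) (G i) (p₀, s) := fun i hi s hs =>
    (hG i hi s hs).mdifferentiableAt (by simp)
  have hle : ∀ i < n, t i ≤ t (i + 1) := fun i hi => (hγ.lt i hi).le
  have hbase : ∀ i < n, ∀ s ∈ Icc (t i) (t (i + 1)), γ s = G i (p₀, s) := by
    intro i hi s hs
    have h := (hGe i hi).self_of_nhdsWithin hp₀ s
    rw [hV.time_base i hi.le, hV.time_base (i + 1) hi] at h
    rw [← h hs, hV.curve_base s ⟨(division_le hle (Nat.zero_le i) hi.le).trans hs.1,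
      hs.2.trans (division_le hle hi le_rfl)⟩]
  have hl : ∀ i < n, t i ∈ Icc (t i) (t (i + 1)) := fun i hi => left_mem_Icc.mpr (hle i hi)
  have hr : ∀ i < n, t (i + 1) ∈ Icc (t i) (t (i + 1)) := fun i hi => right_mem_Icc.mpr (hle i hi)
  let Dp : ℕ → F →L[ℝ] E := fun i => differential (E := E) (fun p => G i (p, τ (i + 1) p)) p₀
  let Dm : ℕ → F →L[ℝ] E := fun i => differential (E := E) (fun p => G i (p, τ i p)) p₀
  let α : ℕ → F →L[ℝ] ℝ := fun i =>
    (metricAt (E := E) (γ (t (i + 1))) (velLeft E γ (t (i + 1)))).comp (Dp i)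
  let β : ℕ → F →L[ℝ] ℝ := fun i =>
    (metricAt (E := E) (γ (t i)) (velRight E γ (t i))).comp (Dm i)
  have hpath : ∀ i < n, ∀ j ≤ n, t j ∈ Icc (t i) (t (i + 1)) →
      MDifferentiableAt 𝓘(ℝ, F) 𝓘(ℝ, E) (fun p => G i (p, τ j p)) p₀ := by
    intro i hi j hj hmem
    have h1 : DifferentiableAt ℝ (fun p => (p, τ j p)) p₀ :=
      differentiableAt_id.prodMk (hτd j hj)
    refine MDifferentiableAt.comp (f := fun p => (p, τ j p)) p₀ ?_ h1.mdifferentiableAt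
    rw [hV.time_base j hj]
    exact hGm i hi _ hmem
  have hDp : ∀ i < n, HasMFDerivWithinAt 𝓘(ℝ, F) 𝓘(ℝ, E) (fun p => G i (p, τ (i + 1) p)) A p₀
      (Dp i) := fun i hi => (hpath i hi (i + 1) hi (hr i hi)).hasMFDerivAt.hasMFDerivWithinAt
  have hDm : ∀ i < n, HasMFDerivWithinAt 𝓘(ℝ, F) 𝓘(ℝ, E) (fun p => G i (p, τ i p)) A p₀
      (Dm i) := fun i hi => (hpath i hi i hi.le (hl i hi)).hasMFDerivAt.hasMFDerivWithinAt
  have hτle : ∀ᶠ p in 𝓝 p₀, ∀ i < n, τ i p ≤ τ (i + 1) p := by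
    have : ∀ i ∈ Finset.range n, ∀ᶠ p in 𝓝 p₀, τ i p ≤ τ (i + 1) p := by
      intro i hi
      have hi := Finset.mem_range.mp hi
      have hlt : τ i p₀ < τ (i + 1) p₀ := by
        rw [hV.time_base i hi.le, hV.time_base (i + 1) hi]
        exact hγ.lt i hi
      exact ((hτd i hi.le).continuousAt.eventually_lt (hτd (i + 1) hi).continuousAt hlt).mono
        fun p hp => hp.le
    exact ((Finset.eventually_all (Finset.range n)).mpr this).mono
      fun p hp i hi => hp i (Finset.mem_range.mpr hi)
  have hplus : ∀ i < n, (fun p => Γ p (τ (i + 1) p)) =ᶠ[𝓝[A] p₀] fun p => G i (p, τ (i + 1) p) := by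
    intro i hi
    filter_upwards [hGe i hi, nhdsWithin_le_nhds hτle] with p hp hp'
    exact hp _ (right_mem_Icc.mpr (hp' i hi))
  have hminus : ∀ i < n, (fun p => Γ p (τ i p)) =ᶠ[𝓝[A] p₀] fun p => G i (p, τ i p) := by
    intro i hi
    filter_upwards [hGe i hi, nhdsWithin_le_nhds hτle] with p hp hp'
    exact hp _ (left_mem_Icc.mpr (hp' i hi))
  refine ⟨Dm 0, (hDm 0 hγ.pos).congr_of_eventuallyEq (hminus 0 hγ.pos)
    ((hminus 0 hγ.pos).self_of_nhdsWithin hp₀), ?_⟩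
  have hseg : ∀ i < n, HasFDerivWithinAt
      (fun p => ∫ s in τ i p..τ (i + 1) p, √(energy E (G i) (p, s))) (α i - β i) A p₀ := by
    intro i hi
    have h0 := hV.time_base i hi.le
    have h1 := hV.time_base (i + 1) hi
    have := hasFDerivAt_integral_speed (E := E) (G := G i) (hτd i hi.le) (hτd (i + 1) hi)
      (by rw [h0, h1]; exact hle i hi) (by rw [h0, h1]; exact hG i hi)
      (by rw [h0, h1]; exact fun s hs => energy_eq_one hγ hi (hGm i hi) (hbase i hi) hs)
      (by
        rw [h0, h1]
        intro s hs e he hes w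
        rw [← hbase i hi s (Ioo_subset_Icc_self hs)] at hes
        rw [← (hγ.geodesic i hi).2 s hs e he hes w]
        refine chartCovAcc_congr ?_ w
        filter_upwards [Icc_mem_nhds hs.1 hs.2] with r hr
        rw [hbase i hi r hr])
    rw [h0, h1, ← hbase i hi _ (hl i hi), ← hbase i hi _ (hr i hi),
      ← velRight_eq (hGm i hi _ (hl i hi)) (hbase i hi) (left_mem_Ico.mpr (hγ.lt i hi)),
      ← velLeft_eq (hGm i hi _ (hr i hi)) (hbase i hi) (right_mem_Ioc.mpr (hγ.lt i hi))] at this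
    exact this.hasFDerivWithinAt
  have hlen : (fun p => curveLength E (Γ p) (τ 0 p) (τ n p)) =ᶠ[𝓝[A] p₀]
      fun p => ∑ i ∈ Finset.range n, ∫ s in τ i p..τ (i + 1) p, √(energy E (G i) (p, s)) := by
    have hall : ∀ᶠ p in 𝓝[A] p₀, ∀ i ∈ Finset.range n,
        (∀ s ∈ Icc (τ i p) (τ (i + 1) p), ContMDiffAt 𝓘(ℝ, F × ℝ) 𝓘(ℝ, E) 2 (G i) (p, s)) ∧
        ∀ s ∈ Icc (τ i p) (τ (i + 1) p), Γ p s = G i (p, s) := by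
      refine (Finset.eventually_all _).mpr fun i hi => ?_
      have hi := Finset.mem_range.mp hi
      have hm : IsManifold 𝓘(ℝ, E) 2 M := inferInstance
      refine Eventually.and (eventually_nhdsWithin_of_eventually_nhds
        (eventually_forall_Icc_of_moving (hτd i hi.le).continuousAt
        (hτd (i + 1) hi).continuousAt ?_ ?_)) (hGe i hi)
      · rw [hV.time_base i hi.le, hV.time_base (i + 1) hi]
        exact hle i hi
      · rw [hV.time_base i hi.le, hV.time_base (i + 1) hi]
        exact fun s hs => (contMDiffAt_iff_contMDiffAt_nhds (by simp)).mp (hG i hi s hs)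
    filter_upwards [hall, nhdsWithin_le_nhds hτle] with p hp hpτ
    have hint : ∀ i ∈ Finset.range n, pathELength 𝓘(ℝ, E) (Γ p) (τ i p) (τ (i + 1) p)
        = ENNReal.ofReal (∫ s in τ i p..τ (i + 1) p, √(energy E (G i) (p, s))) := fun i hi =>
      pathELength_eq_ofReal_integral (hpτ i (Finset.mem_range.mp hi)) (hp i hi).1 (hp i hi).2
    rw [curveLength, pathELength_eq_sum (t := fun i => τ i p) hpτ, Finset.sum_congr rfl hint,
      ENNReal.toReal_sum fun i _ => ENNReal.ofReal_ne_top]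
    refine Finset.sum_congr rfl fun i hi => ENNReal.toReal_ofReal ?_
    exact intervalIntegral.integral_nonneg (hpτ i (Finset.mem_range.mp hi))
      fun s _ => Real.sqrt_nonneg _
  refine HasFDerivWithinAt.congr_of_eventuallyEq
    (hasFDerivWithinAt_sum_telescope (α := α) (β := β) hγ.pos hseg (fun i hi => ?_)
      (fun i hi => ?_)) hlen (hlen.self_of_nhdsWithin hp₀)
  · have hi' : i < n := by omega
    -- The mismatch is split as `g(γ̇⁺, (Dp - Dm) ·) + g(γ̇⁻ - γ̇⁺, Dp ·)`: the first part is null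
    -- because both segments trace the same point, the second by smoothness or reflection.
    have hmatch := hasFDerivWithinAt_zero_of_hasMFDerivWithinAt hp₀ (hDp i hi') (hDm (i + 1) hi)
      ((hplus i hi').symm.trans (hminus (i + 1) hi))
    have h1 := ((metricAt (E := E) (γ (t (i + 1))) (velRight E γ (t (i + 1)))).hasFDerivAt
      (x := (0 : E))).comp_hasFDerivWithinAt p₀ hmatch
    have h2 : HasFDerivWithinAt (fun _ => (0 : ℝ))
        ((metricAt (E := E) (γ (t (i + 1))) (velLeft E γ (t (i + 1)))
          - metricAt (E := E) (γ (t (i + 1))) (velRight E γ (t (i + 1)))).comp (Dp i)) A p₀ := by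
      by_cases hv : velLeft E γ (t (i + 1)) = velRight E γ (t (i + 1))
      · rw [hv, sub_self, ContinuousLinearMap.zero_comp]
        exact hasFDerivWithinAt_const _ _ _
      · refine hasFDerivWithinAt_zero_of_mem_frontier hK hp₀ (hDp i hi') ?_ ?_
        · filter_upwards [hV.reflect (i + 1) (by omega) hi hv, hplus i hi'] with p hp hp'
          rwa [← hp']
        · rw [hV.time_base (i + 1) hi', ← hbase i hi' _ (hr i hi')]
          intro v hvt
          exact sub_eq_zero.mpr ((hγ.reflect (i + 1) (by omega) hi hv).2 v hvt)
    have h3 := h1.add h2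
    refine (h3.congr_fderiv ?_).congr_of_eventuallyEq (Eventually.of_forall fun p => ?_) ?_
    · ext v
      simp [α, β]
    · simp
    · simp
  · have hi' : i < n := by omega
    have hconst : HasMFDerivWithinAt 𝓘(ℝ, F) 𝓘(ℝ, E) (fun _ : F => γ (t n)) A p₀
        (0 : F →L[ℝ] E) := hasMFDerivWithinAt_const _ _ _
    have hmatch := hasFDerivWithinAt_zero_of_hasMFDerivWithinAt hp₀ (hDp i hi') hconst
      ((hplus i hi').symm.trans (by subst hi; exact hV.end_fixed))
    have h1 := ((metricAt (E := E) (γ (t (i + 1))) (velLeft E γ (t (i + 1)))).hasFDerivAt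
      (x := (0 : E))).comp_hasFDerivWithinAt p₀ hmatch
    refine (h1.congr_fderiv ?_).congr_of_eventuallyEq (Eventually.of_forall fun p => ?_) ?_
    · simp [α]
    · simp
    · simp

end FirstVariation


/-! ### Variations over a manifold, read in a chart -/

section Pullback

variable {E : Type*} [NormedAddCommGroup E] [NormedSpace ℝ E]
  {M : Type*} [TopologicalSpace M] [ChartedSpace E M]

theorem tendsto_extChartAt_symm_nhdsWithin (A : Set M) (x : M) :
    Tendsto (extChartAt 𝓘(ℝ, E) x).symm
      (𝓝[(extChartAt 𝓘(ℝ, E) x).symm ⁻¹' A] (extChartAt 𝓘(ℝ, E) x x)) (𝓝[A] x) := by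
  have h := continuousAt_extChartAt_symm (I := 𝓘(ℝ, E)) x
  rw [ContinuousAt, extChartAt_to_inv] at h
  exact tendsto_nhdsWithin_iff.mpr ⟨h.mono_left nhdsWithin_le_nhds, self_mem_nhdsWithin⟩

theorem hasMFDerivAt_extChartAt_symm_self (x : M) :
    HasMFDerivAt 𝓘(ℝ, E) 𝓘(ℝ, E) (extChartAt 𝓘(ℝ, E) x).symm (extChartAt 𝓘(ℝ, E) x x)
      (ContinuousLinearMap.id ℝ E : E →L[ℝ] E) := by
  refine ⟨continuousAt_extChartAt_symm x, ?_⟩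
  rw [writtenInExtChartAt, extChartAt_to_inv]
  simp only [mfld_simps]
  refine (hasFDerivAt_id _).hasFDerivWithinAt.congr_of_eventuallyEq ?_ ?_
  · filter_upwards [nhdsWithin_le_nhds ((chartAt E x).open_target.mem_nhds
      ((chartAt E x).map_source (mem_chart_source E x)))] with z hz
    simp [chartAt_self_eq, hz]
  · simp [chartAt_self_eq]

variable [IsManifold 𝓘(ℝ, E) ∞ M]

/-- A variation parametrized by a subset of a manifold, read in the chart at the base parameter. -/
theorem IsVariation.comp_extChartAt_symm {K : Set M} {γ : ℝ → M} {n : ℕ} {t : ℕ → ℝ} {A : Set M}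
    {x : M} {Γ : M → ℝ → M} {τ : ℕ → M → ℝ}
    (hV : IsVariation (E := E) (F := E) K γ n t A x Γ τ) :
    IsVariation (E := E) (F := E) K γ n t ((extChartAt 𝓘(ℝ, E) x).symm ⁻¹' A)
      (extChartAt 𝓘(ℝ, E) x x) (fun p => Γ ((extChartAt 𝓘(ℝ, E) x).symm p))
      (fun i p => τ i ((extChartAt 𝓘(ℝ, E) x).symm p)) := by
  have hx : (extChartAt 𝓘(ℝ, E) x).symm (extChartAt 𝓘(ℝ, E) x x) = x := extChartAt_to_inv x
  have hs : ContMDiffAt 𝓘(ℝ, E) 𝓘(ℝ, E) ∞ (extChartAt 𝓘(ℝ, E) x).symm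
      (extChartAt 𝓘(ℝ, E) x x) :=
    (contMDiffOn_extChartAt_symm x).contMDiffAt (extChartAt_target_mem_nhds x)
  have ht := tendsto_extChartAt_symm_nhdsWithin (E := E) A x
  constructor
  · simpa only [mem_preimage, hx] using hV.mem
  · simpa only [hx] using hV.time_base
  · simpa only [hx] using hV.curve_base
  · intro i hi
    exact ContMDiffAt.comp (g := τ i) _ (by rw [hx]; exact hV.time_smooth i hi) hs
  · intro i hi
    obtain ⟨G, hG, hGe⟩ := hV.segment_smooth i hi
    refine ⟨fun y => G ((extChartAt 𝓘(ℝ, E) x).symm y.1, y.2), fun s hs' => ?_, ht.eventually hGe⟩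
    refine ContMDiffAt.comp (I' := 𝓘(ℝ, E).prod 𝓘(ℝ, ℝ)) (g := G)
      (f := fun y : E × ℝ => ((extChartAt 𝓘(ℝ, E) x).symm y.1, y.2)) _ ?_ ?_
    · simp only [hx]
      exact hG s hs'
    · exact (ContMDiffAt.comp (g := (extChartAt 𝓘(ℝ, E) x).symm) (f := Prod.fst)
        (extChartAt 𝓘(ℝ, E) x x, s) hs contMDiffAt_fst).prodMk contMDiffAt_snd
  · exact ht.eventually hV.end_fixed
  · exact fun i h0 hi hv => ht.eventually (hV.reflect i h0 hi hv)

end Pullback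

end Billiard

end

/-! ### The two forms of the gradient formula -/

theorem lemma7
    {E : Type*} [NormedAddCommGroup E] [NormedSpace ℝ E] [FiniteDimensional ℝ E]
    {M : Type*} [TopologicalSpace M] [T2Space M] [ChartedSpace E M] [IsManifold 𝓘(ℝ, E) ∞ M]
    [RiemannianBundle (fun x : M => TangentSpace 𝓘(ℝ, E) x)]
    [IsContMDiffRiemannianBundle 𝓘(ℝ, E) ∞ E (fun x : M => TangentSpace 𝓘(ℝ, E) x)]
    (K S : Set M) (hK : Billiard.IsSmoothDomain E K) (hS : Billiard.IsSmoothDomain E S)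
    (hKS : K ⊆ S)
    (γ : ℝ → M) (n : ℕ) (t : ℕ → ℝ) (hγ : Billiard.IsGenGeodesic E K S γ n t)
    (hx : γ (t 0) ∈ frontier S) (hy : γ (t n) ∈ frontier S) :
    -- first variation of the length, for all variations of `γ` with fixed end point
    (∀ (Γ : ℝ → ℝ → M) (τ : ℕ → ℝ → ℝ),
      Billiard.IsVariation E (F := ℝ) K γ n t univ (0 : ℝ) Γ τ →
      HasDerivAt (fun h : ℝ => Billiard.curveLength E (Γ h) (τ 0 h) (τ n h))
        (-(inner ℝ (‖Billiard.velRight E γ (t 0)‖⁻¹ • Billiard.velRight E γ (t 0))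
          (mfderiv 𝓘(ℝ, ℝ) 𝓘(ℝ, E) (fun h : ℝ => Γ h (τ 0 h)) 0 (1 : ℝ) :
            TangentSpace 𝓘(ℝ, E) (γ (t 0)))))
        0) ∧
    -- gradient of the travelling time `T(p) = T(p, y)` at `p = x`, along `A`, for every smooth
    -- family of generalised geodesics from `p ∈ A` to `y` through `γ`
    (∀ (A : Set M) (T : M → ℝ) (Γ : M → ℝ → M) (τ : ℕ → M → ℝ),
      Billiard.IsVariation E (F := E) K γ n t A (γ (t 0)) Γ τ →
      (∀ᶠ p in 𝓝[A] (γ (t 0)),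
        Billiard.IsGenGeodesic E K S (Γ p) n (fun i => τ i p) ∧ Γ p (τ 0 p) = p ∧
          T p = Billiard.curveLength E (Γ p) (τ 0 p) (τ n p)) →
      Billiard.HasGradWithinAt E T A (γ (t 0))
        (-(‖Billiard.velRight E γ (t 0)‖⁻¹ • Billiard.velRight E γ (t 0)))) := by
  have hunit : ‖Billiard.velRight E γ (t 0)‖ = 1 :=
    hγ.unit_right 0 hγ.pos (t 0) (left_mem_Ico.mpr (hγ.lt 0 hγ.pos))
  rw [hunit, inv_one, one_smul]
  refine ⟨fun Γ τ hV => ?_, fun A T Γ τ hV hT => ?_⟩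
  · obtain ⟨D, hD, hL⟩ := Billiard.hasFDerivWithinAt_curveLength hK hγ hV
    rw [hasFDerivWithinAt_univ] at hL
    convert hL.hasDerivAt using 1
    exact congrArg (fun L : ℝ →L[ℝ] E =>
      -Billiard.metricAt (E := E) (γ (t 0)) (Billiard.velRight E γ (t 0)) (L 1))
      (hasMFDerivWithinAt_univ.mp hD).mfderiv
  · obtain ⟨D, hD, hL⟩ := Billiard.hasFDerivWithinAt_curveLength hK hγ hV.comp_extChartAt_symm
    set χ := extChartAt 𝓘(ℝ, E) (γ (t 0)) with hχ
    have hinv : χ.symm (χ (γ (t 0))) = γ (t 0) := extChartAt_to_inv _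
    have ht := Billiard.tendsto_extChartAt_symm_nhdsWithin (E := E) A (γ (t 0))
    have hmem : χ (γ (t 0)) ∈ χ.symm ⁻¹' A := by
      rw [mem_preimage, hinv]
      exact hV.mem
    -- The starting point of `Γ p` is `p`, so its motion agrees with the identity to first order
    -- along `A`; `D` itself may differ from the identity in directions that `A` does not see.
    have hid : HasFDerivWithinAt (fun _ => (0 : E)) (D - ContinuousLinearMap.id ℝ E)
        (χ.symm ⁻¹' A) (χ (γ (t 0))) :=
      Billiard.hasFDerivWithinAt_zero_of_hasMFDerivWithinAt hmem hD
        (Billiard.hasMFDerivAt_extChartAt_symm_self (γ (t 0))).hasMFDerivWithinAt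
        ((ht.eventually hT).mono fun p hp => hp.2.1)
    let ℓ : E →L[ℝ] ℝ := Billiard.metricAt (E := E) (γ (t 0)) (Billiard.velRight E γ (t 0))
    have hTL : HasFDerivWithinAt (T ∘ χ.symm) (-ℓ) (χ.symm ⁻¹' A) (χ (γ (t 0))) := by
      have h1 := (ℓ.hasFDerivAt (x := (0 : E))).comp_hasFDerivWithinAt (χ (γ (t 0))) hid
      have hev : T ∘ χ.symm =ᶠ[𝓝[χ.symm ⁻¹' A] (χ (γ (t 0)))] fun p =>
          Billiard.curveLength E (Γ (χ.symm p)) (τ 0 (χ.symm p)) (τ n (χ.symm p)) + ℓ 0 :=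
        (ht.eventually hT).mono fun p hp => by
          simp only [Function.comp_apply, map_zero, add_zero]
          exact hp.2.2
      refine ((hL.add h1).congr_fderiv ?_).congr_of_eventuallyEq hev (hev.self_of_nhdsWithin hmem)
      ext v
      simp [ℓ]
      ring
    refine ⟨-ℓ, ⟨?_, ?_⟩, fun v => ?_⟩
    -- Continuity of `T` along `A` is recovered from `T = (T ∘ χ.symm) ∘ χ` on the chart domain.
    · have hχc : ContinuousWithinAt χ A (γ (t 0)) := (continuousAt_extChartAt _).continuousWithinAt
      have hsrc := extChartAt_source_mem_nhds (I := 𝓘(ℝ, E)) (γ (t 0))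
      have hcomp : ContinuousWithinAt ((T ∘ χ.symm) ∘ χ) (A ∩ χ.source) (γ (t 0)) :=
        hTL.continuousWithinAt.comp (hχc.mono inter_subset_left) fun z hz => by
          rw [mem_preimage, χ.left_inv hz.2]
          exact hz.1
      refine ((continuousWithinAt_inter hsrc).mp (hcomp.congr (fun z hz => ?_) ?_))
      · simp only [Function.comp_apply, χ.left_inv hz.2]
      · simp only [Function.comp_apply, hinv]
    · exact hTL.mono inter_subset_left
    · simp only [inner_neg_left]
      rfl
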